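/- Let $\{p_m\}_{m\ge 0}$ be one of the classical orthogonal families: Hermite $H_m$ ($\sigma=1$, $\rho_{cop}=e^{-z^2}$), Laguerre $L_m^{(\alpha)}$ with real $\alpha>-1$ ($\sigma=z$, $\rho_{cop}=z^{\alpha}e^{-z}$), or Jacobi $P_m^{(\alpha,\beta)}$ with real $\alpha,\beta>-1$ ($\sigma=1-z^2$, $\rho_{cop}=(1-z)^{\alpha}(1+z)^{\beta}$). Let $k\ge 0$, let $i_1,\dots,i_k$ be pairwise distinct nonnegative integers, and write $$q=W[p_{i_1},\dots,p_{i_k}],\qquad P_l=W[p_{i_1},\dots,p_{i_k},p_l]\quad(l\ge 0,\ l\notin\{i_1,\dots,i_k\}),\qquad \tilde\rho=\frac{\sigma^k\rho_{cop}}{q^2},$$ where $W$ is the Wronskian (the empty Wronskian is $1$). Let $\Gamma$ be a simple (possibly closed) directed smooth or piecewise smooth curve with parametrization $\gamma:[s_a,s_b]\to\overline{\mathbb C}=\mathbb C\cup\{\infty\}$, $[s_a,s_b]\subset\mathbb R$, that avoids the zeros of $q$, on which a single-valued continuous branch of $\rho_{cop}$ is chosen (away from the zeros of $\sigma$). Suppose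 that for every integer $n\ge 0$ the integral $\int_\Gamma z^n\tilde\rho(z)\,dz$ is finite (absolutely convergent) and $$\lim_{s\to s_a+0}\tilde\rho(\gamma(s))\,\sigma(\gamma(s))\,\gamma(s)^n=0,\qquad \lim_{s\to s_b-0}\tilde\rho(\gamma(s))\,\sigma(\gamma(s))\,\gamma(s)^n=0 .$$ Then the polynomials $P_l$ are orthogonal on $\Gamma$ with weight $\tilde\rho$ in the non-Hermitian sense: for all $l\ne n$ in $\mathbb Z_{\ge 0}\setminus\{i_1,\dots,i_k\}$ the following integral converges absolutely and $$\int_\Gamma P_l(z)P_n(z)\tilde\rho(z)\,dz=0 .$$ Example: for every $\alpha>-1$ the polynomial $q=W[L_1^{(\alpha)},L_2^{(\alpha)}]$ has no real zeros, and the polynomials $P_m=W[L_1^{(\alpha)},L_2^{(\alpha)},L_m^{(\alpha)}]$, $m\in\mathbb Z_{\ge 0}\setminus\{1,2\}$, satisfy, for $l\neq n$, $$\int_0^\infty P_l(x)P_n(x)\,\frac{x^{\alpha+2}e^{-x}}{q(x)^2}\,dx=0,$$ the integral being absolutely convergent. -/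

import Mathlib

open Polynomial MeasureTheory Filter Topology

noncomputable section

/-- The physicists' Hermite polynomials `H_m(x) = (-1)^m e^{x²} (d/dx)^m e^{-x²}`,
by the recursion `H_{m+1} = 2 x H_m - H_m'`. -/
def hermiteH : ℕ → ℝ[X]
  | 0 => 1
  | m + 1 => C 2 * X * hermiteH m - derivative (hermiteH m)

/-- The Laguerre polynomials
`L_m^{(α)}(x) = ∑_{j ≤ m} (-1)^j binom(m + α, m - j) x^j / j!`, where
`binom(m + α, m - j) = (α + j + 1) (α + j + 2) ⋯ (α + m) / (m - j)!`. -/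
def laguerreL (α : ℝ) (m : ℕ) : ℝ[X] :=
  ∑ j ∈ Finset.range (m + 1),
    C ((-1) ^ j * (ascPochhammer ℝ (m - j)).eval (α + j + 1)
      / ((m - j).factorial * j.factorial)) * X ^ j

/-- The Jacobi polynomials
`P_m^{(α,β)}(x) = (1/m!) ∑_{j ≤ m} binom(m, j) (m + α + β + 1)_j (α + j + 1)_{m - j} ((x - 1)/2)^j`,
where `(c)_j` is the rising factorial. -/
def jacobiP (α β : ℝ) (m : ℕ) : ℝ[X] :=
  ∑ j ∈ Finset.range (m + 1),
    C ((m.choose j : ℝ) * (ascPochhammer ℝ j).eval (m + α + β + 1)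
      * (ascPochhammer ℝ (m - j)).eval (α + j + 1) / m.factorial)
      * (C (1 / 2) * (X - 1)) ^ j

/-- The classical orthogonal families, with their admissible parameters. -/
inductive ClassicalFamily : Type
  | hermite : ClassicalFamily
  | laguerre (α : ℝ) (hα : -1 < α) : ClassicalFamily
  | jacobi (α β : ℝ) (hα : -1 < α) (hβ : -1 < β) : ClassicalFamily

namespace ClassicalFamily

/-- The sequence `p_m` of classical orthogonal polynomials. -/
def poly : ClassicalFamily → ℕ → ℝ[X]
  | hermite, m => hermiteH m
  | laguerre α _, m => laguerreL α m
  | jacobi α β _ _, m => jacobiP α β m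

/-- The coefficient `σ` of the second derivative in the differential equation of the family. -/
def sigma : ClassicalFamily → ℝ[X]
  | hermite => 1
  | laguerre _ _ => X
  | jacobi _ _ _ _ => 1 - X ^ 2

/-- The values which the (in general multivalued) function `ρ_cop` takes at `z`, for `σ(z) ≠ 0`:
`exp(-z²)`, `z^α exp(-z)`, `(1 - z)^α (1 + z)^β` respectively. -/
def weightValues : ClassicalFamily → ℂ → Set ℂ
  | hermite, z => {Complex.exp (-z ^ 2)}
  | laguerre α _, z => {v | ∃ w : ℂ, Complex.exp w = z ∧ v = Complex.exp (α * w) * Complex.exp (-z)}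
  | jacobi α β _ _, z => {v | ∃ w₁ w₂ : ℂ, Complex.exp w₁ = 1 - z ∧ Complex.exp w₂ = 1 + z ∧
      v = Complex.exp (α * w₁) * Complex.exp (β * w₂)}

/-- `ρ` is a single-valued continuous branch of `ρ_cop` on the set `S`. Nothing is asked at the
zeros of `σ`, which are the branch points. -/
def IsWeightBranch (p : ClassicalFamily) (ρ : ℂ → ℂ) (S : Set ℂ) : Prop :=
  ContinuousOn ρ (S ∩ {z | aeval z p.sigma ≠ 0}) ∧
    ∀ z ∈ S, aeval z p.sigma ≠ 0 → ρ z ∈ p.weightValues z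

end ClassicalFamily

/-- The Wronskian `W[f_0, …, f_{n-1}]`; the empty Wronskian is `1`. -/
def wronskianDet {n : ℕ} (f : Fin n → ℝ[X]) : ℝ[X] :=
  Matrix.det (Matrix.of fun r c : Fin n => derivative^[(r : ℕ)] (f c))

/-- `q = W[p_{i_1}, …, p_{i_k}]`. -/
def ClassicalFamily.q (p : ClassicalFamily) {k : ℕ} (i : Fin k → ℕ) : ℝ[X] :=
  wronskianDet fun j => p.poly (i j)

/-- `P_l = W[p_{i_1}, …, p_{i_k}, p_l]`. -/
def ClassicalFamily.P (p : ClassicalFamily) {k : ℕ} (i : Fin k → ℕ) (l : ℕ) : ℝ[X] :=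
  wronskianDet fun j => p.poly ((Fin.snoc i l : Fin (k + 1) → ℕ) j)

/-- The weight `σ^k ρ / q²`. -/
def ClassicalFamily.tildeWeight (p : ClassicalFamily) {k : ℕ} (i : Fin k → ℕ) (ρ : ℂ → ℂ)
    (z : ℂ) : ℂ :=
  (aeval z p.sigma) ^ k * ρ z / (aeval z (p.q i)) ^ 2

/-- The complex coordinate of a point of the Riemann sphere `OnePoint ℂ` (`0` at `∞`). -/
def sphereCoord (x : OnePoint ℂ) : ℂ := x.elim 0 id

/-- `γ : [a, b] → ℂ ∪ {∞}` parametrizes a simple (possibly closed) piecewise smooth curve on the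
Riemann sphere. The finitely many exceptional parameters comprise the break points and those
where the curve is at `∞`. Off them the curve is finite and `C¹`; neither one-sided derivatives at
the exceptional parameters nor a nonvanishing derivative are required, so that this includes
every usual notion of a simple piecewise smooth curve. -/
structure IsSimplePiecewiseSmooth (γ : ℝ → OnePoint ℂ) (a b : ℝ) : Prop where
  lt : a < b
  continuousOn : ContinuousOn γ (Set.Icc a b)
  injOn_Ico : Set.InjOn γ (Set.Ico a b)
  injOn_Ioc : Set.InjOn γ (Set.Ioc a b)
  smooth : ∃ F : Finset ℝ, ∀ s ∈ Set.Ioo a b, s ∉ F →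
    γ s ≠ OnePoint.infty ∧ ContDiffAt ℝ 1 (fun t => sphereCoord (γ t)) s

/-- The finite points of the curve, its endpoints removed. -/
def curveInterior (γ : ℝ → OnePoint ℂ) (a b : ℝ) : Set ℂ :=
  {z | ∃ s ∈ Set.Ioo a b, γ s = (z : OnePoint ℂ)}

/-- The integrand `f(γ(s)) γ'(s)` of the line integral `∫_Γ f(z) dz`. -/
def lineIntegrand (γ : ℝ → OnePoint ℂ) (f : ℂ → ℂ) (s : ℝ) : ℂ :=
  f (sphereCoord (γ s)) * deriv (fun t => sphereCoord (γ t)) s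

/-- The line integral `∫_Γ f(z) dz` is (absolutely) convergent. -/
def LineIntegrable (γ : ℝ → OnePoint ℂ) (a b : ℝ) (f : ℂ → ℂ) : Prop :=
  IntegrableOn (lineIntegrand γ f) (Set.Ioo a b)

/-- The line integral `∫_Γ f(z) dz`. -/
def lineIntegral (γ : ℝ → OnePoint ℂ) (a b : ℝ) (f : ℂ → ℂ) : ℂ :=
  ∫ s in Set.Ioo a b, lineIntegrand γ f s

end

/-! All $p_m$ satisfy $\sigma y''+\tau y'+\lambda_m y=0$ with pairwise distinct $\lambda_m$, where
$\deg\sigma\le 2$ and $\deg\tau\le 1$. Put $V=W[p_{i_1},\dots,p_{i_k},p_l,p_n]$. The heart of the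
proof is that $P_lP_n\tilde\rho$ has an explicit primitive: $(\sigma^{k+1}\rho
V/q)'=(\lambda_l-\lambda_n)P_lP_n\tilde\rho$. By Pearson's equation $(\sigma\rho)'=\tau\rho$ this
reduces to the polynomial identity `wronskianDet_differential_identity`. That identity comes from
computing one determinant in two ways: the Wronskian matrix of all $k+2$ functions $c_j$, with last
row replaced by $\lambda_jW[f,c_j]$, where $f$ is the common part and $\lambda_j$ belongs to $c_j$.

The analytic part integrates this derivative along the curve. The primitive vanishes at both ends by
the limit hypotheses. It must also be continuous at the finitely many interior parameters where the
curve meets a zero of $\sigma$ or $\infty$. At zeros of $\sigma$ this holds because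
$|\sigma^{k+1}\rho|$ behaves like a positive power, and at $\infty$ because all moments of
$\tilde\rho$ converge (`continuousAt_weightedPrimitive`). Dividing by $\lambda_l-\lambda_n\ne0$
gives orthogonality. -/

/-! ### Wronskians: row replacement, derivative and cofactors -/

theorem derivative_det {n : Type*} [Fintype n] [DecidableEq n] {R : Type*} [CommRing R]
    (M : Matrix n n R[X]) :
    derivative M.det = ∑ r, (M.updateRow r fun j => derivative (M r j)).det := by
  have h : ∀ N : Matrix n n R[X], N.det
      = ∑ s : Equiv.Perm n, Equiv.Perm.sign s • ∏ i, N i (s i) := fun N => by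
    rw [← Matrix.det_transpose, Matrix.det_apply]; rfl
  simp_rw [h]
  rw [Finset.sum_comm, derivative_sum]
  refine Finset.sum_congr rfl fun s _ => ?_
  rw [← Finset.smul_sum, Units.smul_def, Units.smul_def, derivative_smul, derivative_prod_finset]
  congr 1
  refine Finset.sum_congr rfl fun i _ => ?_
  rw [← Finset.mul_prod_erase _ _ (Finset.mem_univ i), Matrix.updateRow_self, mul_comm]
  congr 1
  refine Finset.prod_congr rfl fun j hj => ?_
  rw [Matrix.updateRow_ne (Finset.ne_of_mem_erase hj)]

/-- The Wronskian matrix of `c` with its last row replaced by `x`, as a function of `x`. -/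
noncomputable def wronskianLastRow {n : ℕ} (c : Fin (n + 1) → ℝ[X]) (x : Fin (n + 1) → ℝ[X]) : ℝ[X] :=
  ((Matrix.of fun r j : Fin (n + 1) => derivative^[(r : ℕ)] (c j)).updateRow (Fin.last n) x).det

section WronskianLastRow

variable {n : ℕ} (c : Fin (n + 1) → ℝ[X])

theorem wronskianLastRow_self :
    wronskianLastRow c (fun j => derivative^[n] (c j)) = wronskianDet c := by
  unfold wronskianLastRow wronskianDet
  congr 1
  convert Matrix.updateRow_eq_self _ (Fin.last n)
  simp

theorem wronskianLastRow_add (x y : Fin (n + 1) → ℝ[X]) :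
    wronskianLastRow c (fun j => x j + y j) = wronskianLastRow c x + wronskianLastRow c y :=
  Matrix.det_updateRow_add _ _ x y

theorem wronskianLastRow_mul (a : ℝ[X]) (x : Fin (n + 1) → ℝ[X]) :
    wronskianLastRow c (fun j => a * x j) = a * wronskianLastRow c x :=
  Matrix.det_updateRow_smul _ _ a x

theorem wronskianLastRow_sum {ι : Type*} (s : Finset ι) (x : ι → Fin (n + 1) → ℝ[X]) :
    wronskianLastRow c (fun j => ∑ i ∈ s, x i j) = ∑ i ∈ s, wronskianLastRow c (x i) := by
  classical
  induction s using Finset.induction_on with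
  | empty => simpa using wronskianLastRow_mul c 0 0
  | insert a s ha ih =>
    simp_rw [Finset.sum_insert ha]
    rw [wronskianLastRow_add, ih]

theorem wronskianLastRow_iterate {r : ℕ} (hr : r < n) :
    wronskianLastRow c (fun j => derivative^[r] (c j)) = 0 := by
  refine Matrix.det_zero_of_row_eq (i := ⟨r, by omega⟩) (j := Fin.last n) ?_ ?_
  · intro h; simp [Fin.ext_iff] at h; omega
  · rw [Matrix.updateRow_self, Matrix.updateRow_ne]
    · rfl
    · intro h; simp [Fin.ext_iff] at h; omega

/-- In the row-by-row product rule, differentiating any row but the last makes it equal to the next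
one, so only one term survives. -/
theorem derivative_wronskianDet :
    derivative (wronskianDet c) = wronskianLastRow c (fun j => derivative^[n + 1] (c j)) := by
  unfold wronskianDet
  rw [derivative_det, Fin.sum_univ_castSucc, Finset.sum_eq_zero, zero_add]
  · unfold wronskianLastRow
    simp only [Matrix.of_apply, Fin.val_last, Function.iterate_succ_apply']
  · intro r _
    refine Matrix.det_zero_of_row_eq (i := r.castSucc) (j := r.succ) (Fin.castSucc_lt_succ).ne ?_
    rw [Matrix.updateRow_self, Matrix.updateRow_ne (Fin.castSucc_lt_succ).ne']
    ext1 j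
    simp [Function.iterate_succ_apply']

theorem wronskianLastRow_eq_sum (x : Fin (n + 1) → ℝ[X]) :
    wronskianLastRow c x = ∑ j : Fin (n + 1), (-1) ^ (n + (j : ℕ)) * x j * wronskianDet (c ∘ j.succAbove) := by
  unfold wronskianLastRow wronskianDet
  rw [Matrix.det_succ_row _ (Fin.last n)]
  refine Finset.sum_congr rfl fun j _ => ?_
  rw [Matrix.updateRow_self, Fin.val_last]
  congr 2
  ext1 a b
  rw [Matrix.submatrix_apply, Matrix.updateRow_ne (Fin.succAbove_ne _ _)]
  simp

end WronskianLastRow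

/-- The cofactors of the last column of a Wronskian matrix. -/
noncomputable def wronskianCofactor {k : ℕ} (f : Fin k → ℝ[X]) (r : Fin (k + 1)) : ℝ[X] :=
  (-1) ^ (r + k : ℕ) * Matrix.det (Matrix.of fun a b : Fin k =>
    derivative^[(r.succAbove a : ℕ)] (f b))

theorem wronskianDet_snoc {k : ℕ} (f : Fin k → ℝ[X]) (g : ℝ[X]) :
    wronskianDet (Fin.snoc f g : Fin (k + 1) → ℝ[X])
      = ∑ r : Fin (k + 1), wronskianCofactor f r * derivative^[(r : ℕ)] g := by
  unfold wronskianDet wronskianCofactor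
  rw [Matrix.det_succ_column _ (Fin.last k)]
  refine Finset.sum_congr rfl fun r _ => ?_
  have : (Matrix.of fun a b : Fin (k + 1) => derivative^[(a : ℕ)]
      ((Fin.snoc f g : Fin (k + 1) → ℝ[X]) b)).submatrix r.succAbove (Fin.last k).succAbove
      = Matrix.of fun a b : Fin k => derivative^[(r.succAbove a : ℕ)] (f b) := by
    ext1 a b
    simp
  rw [this]
  simp only [Fin.val_last, Matrix.of_apply, Fin.snoc_last]
  ring

theorem wronskianCofactor_last {k : ℕ} (f : Fin k → ℝ[X]) :
    wronskianCofactor f (Fin.last k) = wronskianDet f := by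
  simp [wronskianCofactor, wronskianDet, ← two_mul]

/-- Deleting the row of order $k$ leaves the orders $0,\dots,k-1,k+1$, which is the one surviving
term of the derivative of the Wronskian. -/
theorem wronskianCofactor_penultimate {k : ℕ} (f : Fin (k + 1) → ℝ[X]) :
    wronskianCofactor f (Fin.last k).castSucc = -derivative (wronskianDet f) := by
  rw [derivative_wronskianDet, wronskianCofactor, wronskianLastRow]
  have : (-1 : ℝ[X]) ^ (((Fin.last k).castSucc : ℕ) + (k + 1)) = -1 := by
    rw [Fin.val_castSucc, Fin.val_last]
    exact Odd.neg_one_pow ⟨k, by ring⟩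
  rw [this, neg_one_mul]
  congr 2
  ext1 a b
  induction a using Fin.lastCases with
  | last => rw [Matrix.updateRow_self]; simp
  | cast a =>
    rw [Matrix.updateRow_ne (Fin.castSucc_lt_last a).ne]
    rw [Matrix.of_apply, Matrix.of_apply, Fin.succAbove_of_castSucc_lt]
    · simp
    · simp [Fin.lt_def]

/-! ### The differential identity for Wronskians of eigenfunctions -/

/-- Leibniz's rule applied $r$ times to the equation stops early because $s'''=t''=0$. Hence the
eigenvalue times the $r$-th derivative involves only the orders $r$, $r+1$, $r+2$. -/
theorem iterate_derivative_hypergeometric {s t f : ℝ[X]} {m : ℝ}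
    (hs : derivative (derivative (derivative s)) = 0) (ht : derivative (derivative t) = 0)
    (hf : s * derivative (derivative f) + t * derivative f + C m * f = 0) (r : ℕ) :
    C m * derivative^[r] f = (-s) * derivative^[r + 2] f
      + (-(r * derivative s + t) * derivative^[r + 1] f
      + (-((r.choose 2 : ℝ[X]) * derivative (derivative s) + r * derivative t))
        * derivative^[r] f) := by
  induction r with
  | zero => simp; linear_combination hf
  | succ r ih =>
    have h := congrArg derivative ih
    simp only [derivative_mul, derivative_add, derivative_neg, derivative_natCast, derivative_C,
      ← Function.iterate_succ_apply' derivative, hs, ht] at h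
    have hc : ((r + 1).choose 2 : ℝ[X]) = r + r.choose 2 := by
      rw [Nat.choose_succ_succ' r 1, Nat.choose_one_right]; push_cast; ring
    simp only [Nat.succ_eq_add_one, add_assoc, Nat.reduceAdd] at h ⊢
    rw [hc]; push_cast
    linear_combination h

/-- The differential identity that makes two Wronskians with a common part orthogonal. -/
theorem wronskianDet_differential_identity {k : ℕ} (f : Fin k → ℝ[X]) (g h s t : ℝ[X])
    (m : Fin k → ℝ) (mg mh : ℝ)
    (hs : derivative (derivative (derivative s)) = 0) (ht : derivative (derivative t) = 0)
    (hf : ∀ j, s * derivative (derivative (f j)) + t * derivative (f j) + C (m j) * f j = 0)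
    (hg : s * derivative (derivative g) + t * derivative g + C mg * g = 0)
    (hh : s * derivative (derivative h) + t * derivative h + C mh * h = 0) :
    wronskianDet f * (s * derivative (wronskianDet
          (Fin.snoc (Fin.snoc f g : Fin (k + 1) → ℝ[X]) h : Fin (k + 2) → ℝ[X]))
        + (k * derivative s + t) * wronskianDet
          (Fin.snoc (Fin.snoc f g : Fin (k + 1) → ℝ[X]) h : Fin (k + 2) → ℝ[X]))
      - s * derivative (wronskianDet f) * wronskianDet
          (Fin.snoc (Fin.snoc f g : Fin (k + 1) → ℝ[X]) h : Fin (k + 2) → ℝ[X])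
      = C (mg - mh) * (wronskianDet (Fin.snoc f g : Fin (k + 1) → ℝ[X])
        * wronskianDet (Fin.snoc f h : Fin (k + 1) → ℝ[X])) := by
  set c : Fin (k + 2) → ℝ[X] := Fin.snoc (Fin.snoc f g : Fin (k + 1) → ℝ[X]) h with hc
  set mm : Fin (k + 2) → ℝ := Fin.snoc (Fin.snoc m mg : Fin (k + 1) → ℝ) mh with hmm
  have hode : ∀ j, s * derivative (derivative (c j)) + t * derivative (c j) + C (mm j) * c j = 0 := by
    intro j
    induction j using Fin.lastCases with
    | last => simpa [hc, hmm] using hh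
    | cast j =>
      induction j using Fin.lastCases with
      | last => simpa [hc, hmm] using hg
      | cast j => simpa [hc, hmm] using hf j
  have hrow : ∀ r : ℕ, wronskianLastRow c (fun j => C (mm j) * derivative^[r] (c j))
      = (-s) * wronskianLastRow c (fun j => derivative^[r + 2] (c j))
      + (-(r * derivative s + t) * wronskianLastRow c (fun j => derivative^[r + 1] (c j))
      + (-((r.choose 2 : ℝ[X]) * derivative (derivative s) + r * derivative t))
        * wronskianLastRow c (fun j => derivative^[r] (c j))) := by
    intro r
    rw [← wronskianLastRow_mul, ← wronskianLastRow_mul, ← wronskianLastRow_mul,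
      ← wronskianLastRow_add, ← wronskianLastRow_add]
    congr 1
    ext1 j
    exact iterate_derivative_hypergeometric hs ht (hode j) r
  -- Orders up to $k$ repeat an earlier row and contribute zero. Only the orders $k+1$ and $k+2$
  -- survive; they give the full Wronskian and its derivative.
  have hlow : ∀ r : ℕ, r + 2 ≤ k →
      wronskianLastRow c (fun j => C (mm j) * derivative^[r] (c j)) = 0 := by
    intro r hr
    rw [hrow, wronskianLastRow_iterate c (by omega), wronskianLastRow_iterate c (by omega),
      wronskianLastRow_iterate c (by omega)]
    ring
  have hpen : ∀ r : ℕ, r + 1 = k →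
      wronskianLastRow c (fun j => C (mm j) * derivative^[r] (c j)) = -(s * wronskianDet c) := by
    intro r hr
    rw [hrow, wronskianLastRow_iterate c (show r < k + 1 by omega),
      wronskianLastRow_iterate c (show r + 1 < k + 1 by omega), ← wronskianLastRow_self,
      show r + 2 = k + 1 by omega]
    ring
  have hlast : wronskianLastRow c (fun j => C (mm j) * derivative^[k] (c j))
      = -(s * derivative (wronskianDet c) + (k * derivative s + t) * wronskianDet c) := by
    rw [hrow, wronskianLastRow_iterate c (show k < k + 1 by omega), derivative_wronskianDet,
      ← wronskianLastRow_self]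
    ring
  -- First evaluation: expand $W[f,c_j]$ along its last column. Only the two top cofactors, $W[f]$
  -- and $-W[f]'$, meet a nonzero determinant.
  have hlhs : wronskianLastRow c
      (fun j => C (mm j) * wronskianDet (Fin.snoc f (c j) : Fin (k + 1) → ℝ[X]))
      = -(wronskianDet f * (s * derivative (wronskianDet c)
        + (k * derivative s + t) * wronskianDet c)
        - s * derivative (wronskianDet f) * wronskianDet c) := by
    have : (fun j => C (mm j) * wronskianDet (Fin.snoc f (c j) : Fin (k + 1) → ℝ[X]))
        = fun j => ∑ r : Fin (k + 1), wronskianCofactor f r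
          * (C (mm j) * derivative^[(r : ℕ)] (c j)) := by
      ext1 j
      rw [wronskianDet_snoc, Finset.mul_sum]
      exact Finset.sum_congr rfl fun r _ => by ring
    rw [this, wronskianLastRow_sum c Finset.univ fun (r : Fin (k + 1)) j =>
      wronskianCofactor f r * (C (mm j) * derivative^[(r : ℕ)] (c j))]
    simp_rw [wronskianLastRow_mul]
    rw [Fin.sum_univ_castSucc, wronskianCofactor_last, Fin.val_last, hlast]
    cases k with
    -- There is no penultimate cofactor here; $W[f]=1$ has zero derivative.
    | zero => simp [wronskianDet]
    | succ k =>
      rw [Fin.sum_univ_castSucc, wronskianCofactor_penultimate, Finset.sum_eq_zero]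
      · rw [Fin.val_castSucc, Fin.val_last, hpen k rfl]
        ring
      · intro r _
        rw [hlow _ (by simp), mul_zero]
  -- Second evaluation: expand along the replaced row. $W[f,c_j]=0$ when $c_j$ is one of the $f$'s,
  -- so only the entries of $g$ and $h$ remain.
  have hrhs : wronskianLastRow c
      (fun j => C (mm j) * wronskianDet (Fin.snoc f (c j) : Fin (k + 1) → ℝ[X]))
      = -(C (mg - mh) * (wronskianDet (Fin.snoc f g : Fin (k + 1) → ℝ[X])
        * wronskianDet (Fin.snoc f h : Fin (k + 1) → ℝ[X]))) := by
    rw [wronskianLastRow_eq_sum, Fin.sum_univ_castSucc, Fin.sum_univ_castSucc,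
      Finset.sum_eq_zero]
    · have e1 : c ∘ (Fin.last (k + 1)).succAbove = (Fin.snoc f g : Fin (k + 1) → ℝ[X]) := by
        ext1 j; simp [hc]
      have e2 : c ∘ (Fin.last k).castSucc.succAbove = (Fin.snoc f h : Fin (k + 1) → ℝ[X]) := by
        ext1 j
        induction j using Fin.lastCases with
        | last => simp [hc]
        | cast j =>
          rw [Function.comp_apply, Fin.succAbove_of_castSucc_lt _ _ (by simp [Fin.lt_def])]
          simp [hc]
      have e3 : c (Fin.last k).castSucc = g := by simp [hc]
      have e4 : c (Fin.last (k + 1)) = h := by simp [hc]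
      have e5 : mm (Fin.last k).castSucc = mg := by simp [hmm]
      have e6 : mm (Fin.last (k + 1)) = mh := by simp [hmm]
      rw [e1, e2, e3, e4, e5, e6, Fin.val_castSucc, Fin.val_last, Fin.val_last, C_sub,
        Odd.neg_one_pow (show Odd (k + 1 + k) from ⟨k, by ring⟩),
        Even.neg_one_pow (show Even (k + 1 + (k + 1)) from ⟨k + 1, by ring⟩)]
      ring
    · intro j _
      have : wronskianDet (Fin.snoc f (c j.castSucc.castSucc) : Fin (k + 1) → ℝ[X]) = 0 := by
        refine Matrix.det_zero_of_column_eq (i := j.castSucc) (j := Fin.last k)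
          (Fin.castSucc_lt_last j).ne fun r => ?_
        simp [hc]
      rw [this]
      ring
  rw [hlhs] at hrhs
  exact neg_injective hrhs

/-! ### Differential equations of the Hermite, Laguerre and Jacobi polynomials -/

theorem coeff_sum_range_C_mul_X_pow (a : ℕ → ℝ) (m n : ℕ) :
    (∑ j ∈ Finset.range (m + 1), C (a j) * X ^ j : ℝ[X]).coeff n = if n ≤ m then a n else 0 := by
  simp [coeff_X_pow]

theorem ascPochhammer_eval_succ_left (n : ℕ) (x : ℝ) :
    (ascPochhammer ℝ (n + 1)).eval x = x * (ascPochhammer ℝ n).eval (x + 1) := by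
  rw [ascPochhammer_succ_left, eval_mul, eval_X, eval_comp]
  simp

/-- The two claims feed each other: the equation for $H_m$ turns the differentiated recursion into
$H_{m+1}'=2(m+1)H_m$, which with the recursion yields the equation for $H_{m+1}$. -/
theorem derivative_hermiteH_succ_and_hermiteH_ode (m : ℕ) :
    derivative (hermiteH (m + 1)) = C (2 * (m + 1) : ℝ) * hermiteH m ∧
    derivative (derivative (hermiteH m)) - C 2 * X * derivative (hermiteH m)
      + C (2 * m : ℝ) * hermiteH m = 0 := by
  have key : ∀ m : ℕ, derivative (derivative (hermiteH m)) - C 2 * X * derivative (hermiteH m)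
      + C (2 * m : ℝ) * hermiteH m = 0 →
      derivative (hermiteH (m + 1)) = C (2 * (m + 1) : ℝ) * hermiteH m := by
    intro m h
    simp only [hermiteH, derivative_sub, derivative_mul, derivative_C, derivative_X, C_mul, C_add,
      C_1] at h ⊢
    linear_combination -h
  have ode : ∀ m : ℕ, derivative (derivative (hermiteH m)) - C 2 * X * derivative (hermiteH m)
      + C (2 * m : ℝ) * hermiteH m = 0 := by
    intro m
    induction m with
    | zero => simp [hermiteH]
    | succ m ih =>
      rw [key m ih, hermiteH, derivative_C_mul, Nat.cast_succ]
      ring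
  exact ⟨key m (ode m), ode m⟩

/-- Comparing coefficients of $X^n$ reduces the equation to the two-term recurrence `hrec`; its
factor $m-n$ accounts for the cutoff at degree $m$. -/
theorem laguerreL_ode (α : ℝ) (m : ℕ) :
    X * derivative (derivative (laguerreL α m))
      + (C (α + 1) - X) * derivative (laguerreL α m) + C (m : ℝ) * laguerreL α m = 0 := by
  have hc := coeff_sum_range_C_mul_X_pow (fun j => (-1) ^ j *
    (ascPochhammer ℝ (m - j)).eval (α + j + 1) / ((m - j).factorial * j.factorial)) m
  change ∀ n, (laguerreL α m).coeff n = _ at hc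
  have hrec : ∀ n : ℕ, (n + 1) * (n + α + 1) * (laguerreL α m).coeff (n + 1)
      + (m - n) * (laguerreL α m).coeff n = 0 := by
    intro n
    rw [hc, hc]
    rcases lt_trichotomy n m with h | rfl | h
    · obtain ⟨d, rfl⟩ := Nat.exists_eq_add_of_lt h
      rw [if_pos (by omega), if_pos (by omega), show n + d + 1 - n = d + 1 by omega,
        show n + d + 1 - (n + 1) = d by omega, ascPochhammer_eval_succ_left,
        Nat.factorial_succ d, Nat.factorial_succ n, pow_succ,
        show α + (n + 1 : ℕ) + 1 = α + n + 1 + 1 by push_cast; ring]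
      have := d.factorial_ne_zero
      have := n.factorial_ne_zero
      push_cast
      field_simp
      ring
    · simp
    · rw [if_neg (by omega), if_neg (by omega)]; ring
  ext n
  have h := hrec n
  rw [sub_mul]
  cases n with
  | zero =>
    simp [coeff_derivative, mul_coeff_zero] at h ⊢
    linarith
  | succ n =>
    simp [coeff_X_mul, coeff_derivative, coeff_C_mul, -map_add] at h ⊢
    linear_combination h

/-- In the variable $t=(x-1)/2$ the equation becomes hypergeometric, with singular points $0$ and
$-1$, and its coefficients satisfy a two-term recurrence. -/
theorem jacobiP_ode (α β : ℝ) (m : ℕ) :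
    (1 - X ^ 2) * derivative (derivative (jacobiP α β m))
      + (C (β - α) - C (α + β + 2) * X) * derivative (jacobiP α β m)
      + C (m * (m + α + β + 1)) * jacobiP α β m = 0 := by
  set y : ℝ[X] := ∑ j ∈ Finset.range (m + 1), C ((m.choose j : ℝ) *
    (ascPochhammer ℝ j).eval (m + α + β + 1) *
    (ascPochhammer ℝ (m - j)).eval (α + j + 1) / m.factorial) * X ^ j with hy
  have hc := coeff_sum_range_C_mul_X_pow (fun j => (m.choose j : ℝ) *
    (ascPochhammer ℝ j).eval (m + α + β + 1) *
    (ascPochhammer ℝ (m - j)).eval (α + j + 1) / m.factorial) m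
  rw [← hy] at hc
  have hrec : ∀ n : ℕ, (n + 1) * (n + α + 1) * y.coeff (n + 1)
      + (n - m) * (n + m + α + β + 1) * y.coeff n = 0 := by
    intro n
    rw [hc, hc]
    rcases lt_trichotomy n m with h | rfl | h
    · have hch : ((m.choose (n + 1) : ℕ) : ℝ) * (n + 1) = m.choose n * (m - n) := by
        have := Nat.choose_succ_right_eq m n
        rw [← Nat.cast_sub h.le]
        exact_mod_cast this
      obtain ⟨d, rfl⟩ := Nat.exists_eq_add_of_lt h
      rw [if_pos (by omega), if_pos (by omega), show n + d + 1 - n = d + 1 by omega,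
        show n + d + 1 - (n + 1) = d by omega, ascPochhammer_eval_succ_left d,
        show α + (n + 1 : ℕ) + 1 = α + n + 1 + 1 by push_cast; ring,
        ascPochhammer_succ_eval n]
      have := (n + d + 1).factorial_ne_zero
      field_simp
      linear_combination (↑n + α + 1) * (eval (((n + d + 1 : ℕ) : ℝ) + α + β + 1) (ascPochhammer ℝ n))
        * (((n + d + 1 : ℕ) : ℝ) + α + β + 1 + n) * eval (α + n + 1 + 1) (ascPochhammer ℝ d) * hch
    · simp
    · rw [if_neg (by omega), if_neg (by omega)]; ring
  have hode : X * (1 + X) * derivative (derivative y)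
      + (C (α + 1) + C (α + β + 2) * X) * derivative y - C (m * (m + α + β + 1)) * y = 0 := by
    rw [show X * (1 + X) * derivative (derivative y)
      + (C (α + 1) + C (α + β + 2) * X) * derivative y - C (m * (m + α + β + 1)) * y
      = X * derivative (derivative y) + X * (X * derivative (derivative y))
      + C (α + 1) * derivative y + C (α + β + 2) * (X * derivative y)
      - C (m * (m + α + β + 1)) * y by ring]
    ext n
    have h := hrec n
    rcases n with _ | _ | n
    · simp [coeff_derivative, mul_coeff_zero, -map_add, -map_mul] at h ⊢
      linear_combination h
    · simp [coeff_X_mul, coeff_derivative, mul_coeff_zero, coeff_C_mul, -map_add, -map_mul] at h ⊢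
      linear_combination h
    · simp [coeff_X_mul, coeff_derivative, coeff_C_mul, -map_add, -map_mul] at h ⊢
      linear_combination h
  have hJ : jacobiP α β m = y.comp (C (1 / 2) * (X - 1)) := by
    rw [hy, jacobiP, ← coe_compRingHom_apply, map_sum]
    simp only [coe_compRingHom_apply, mul_comp, C_comp, X_pow_comp]
  have hd : ∀ p : ℝ[X], derivative (p.comp (C (1 / 2) * (X - 1)))
      = C (1 / 2) * (derivative p).comp (C (1 / 2) * (X - 1)) := by
    intro p
    rw [derivative_comp]
    simp
  have h := congrArg (fun p : ℝ[X] => p.comp (C (1 / 2) * (X - 1))) hode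
  simp only [sub_comp, add_comp, mul_comp, C_comp, X_comp, zero_comp, one_comp] at h
  rw [hJ, hd, derivative_C_mul, hd]
  have h2 : (C (1 / 2) : ℝ[X]) * 2 = 1 := by
    rw [show (2 : ℝ[X]) = C 2 from rfl, ← C_mul]; norm_num
  have h3 : (C (β - α) : ℝ[X]) = C (α + β + 2) - C (α + 1) * 2 := by
    rw [show (2 : ℝ[X]) = C 2 from rfl, ← C_mul, ← C_sub]; congr 1; ring
  rw [h3]
  -- From here $e$ and $t$ are opaque: $2e=1$ and $X=1+2t$ suffice for the change of variable.
  set e : ℝ[X] := C (1 / 2)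
  have h4 : X = 1 + 2 * (e * (X - 1)) := by linear_combination -(X - 1) * h2
  set t := e * (X - 1)
  clear_value t e y
  rw [h4]
  linear_combination (-1) * h - t * (1 + t) * (2 * e + 1) * (derivative (derivative y)).comp t * h2
    - (C (α + 1) + C (α + β + 2) * t) * (derivative y).comp t * h2

/-! ### The three families treated uniformly -/

namespace ClassicalFamily

/-- The coefficient `τ` of the first derivative in the differential equation of the family. -/
noncomputable def tau : ClassicalFamily → ℝ[X]
  | hermite => -(C 2 * X)
  | laguerre α _ => C (α + 1) - X
  | jacobi α β _ _ => C (β - α) - C (α + β + 2) * X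

/-- The negative of the eigenvalue of `p_m` under the operator `σ D² + τ D`. -/
def eigenvalue : ClassicalFamily → ℕ → ℝ
  | hermite, m => 2 * m
  | laguerre _ _, m => m
  | jacobi α β _ _, m => m * (m + α + β + 1)

theorem ode (p : ClassicalFamily) (m : ℕ) :
    p.sigma * derivative (derivative (p.poly m)) + p.tau * derivative (p.poly m)
      + C (p.eigenvalue m) * p.poly m = 0 := by
  cases p with
  | hermite =>
    have := (derivative_hermiteH_succ_and_hermiteH_ode m).2
    simp only [sigma, tau, poly, eigenvalue]
    linear_combination this
  | laguerre α _ => exact laguerreL_ode α m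
  | jacobi α β _ _ => exact jacobiP_ode α β m

theorem eigenvalue_injective (p : ClassicalFamily) : Function.Injective p.eigenvalue := by
  intro m n h
  cases p with
  | hermite => simpa [eigenvalue] using h
  | laguerre α _ => simpa [eigenvalue] using h
  | jacobi α β hα hβ =>
    simp only [eigenvalue] at h
    by_contra hmn
    have h1 : ((m : ℝ) - n) * (m + n + α + β + 1) = 0 := by linear_combination h
    -- Since $m+n\ge1$ and $\alpha+\beta>-2$, the second factor is positive.
    have h2 : (1 : ℝ) ≤ m + n := by exact_mod_cast (by omega : 1 ≤ m + n)
    rcases mul_eq_zero.1 h1 with h3 | h3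
    · exact hmn (by exact_mod_cast sub_eq_zero.1 h3)
    · linarith

theorem derivative_derivative_derivative_sigma (p : ClassicalFamily) :
    derivative (derivative (derivative p.sigma)) = 0 := by
  cases p <;> simp [sigma]

theorem derivative_derivative_tau (p : ClassicalFamily) :
    derivative (derivative p.tau) = 0 := by
  cases p <;> simp [tau]

/-- Up to the factor `ρ̃ / q²`, the derivative of `σ^(k+1) ρ A / q`. -/
noncomputable def primitiveNumerator (p : ClassicalFamily) {k : ℕ} (i : Fin k → ℕ) (A : ℝ[X]) : ℝ[X] :=
  p.q i * (p.sigma * derivative A + (k * derivative p.sigma + p.tau) * A)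
    - p.sigma * derivative (p.q i) * A

/-- The witness is the full Wronskian $W[p_{i_1},\dots,p_{i_k},p_l,p_n]$. -/
theorem exists_primitiveNumerator_eq (p : ClassicalFamily) {k : ℕ} (i : Fin k → ℕ) (l n : ℕ) :
    ∃ V : ℝ[X], p.primitiveNumerator i V
      = C (p.eigenvalue l - p.eigenvalue n) * (p.P i l * p.P i n) := by
  have hP : ∀ m, p.P i m
      = wronskianDet (Fin.snoc (fun j => p.poly (i j)) (p.poly m) : Fin (k + 1) → ℝ[X]) := by
    intro m
    unfold P
    congr 1
    exact Fin.comp_snoc p.poly i m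
  rw [hP, hP]
  exact ⟨_, wronskianDet_differential_identity (fun j => p.poly (i j)) (p.poly l) (p.poly n)
    p.sigma p.tau (fun j => p.eigenvalue (i j)) _ _ p.derivative_derivative_derivative_sigma
    p.derivative_derivative_tau (fun j => p.ode _) (p.ode l) (p.ode n)⟩

end ClassicalFamily

/-! ### Local branches of the weight and Pearson's equation -/

theorem exists_local_log {z₀ w₀ : ℂ} (h : Complex.exp w₀ = z₀) :
    ∃ L : ℂ → ℂ, L z₀ = w₀ ∧ HasDerivAt L z₀⁻¹ z₀ ∧ ∀ᶠ z in 𝓝 z₀, ContinuousAt L z ∧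
      ∀ w, Complex.exp w = z → ∃ n : ℤ, w = L z + n * (2 * Real.pi * Complex.I) := by
  have hz : z₀ ≠ 0 := h ▸ Complex.exp_ne_zero w₀
  have h1 : z₀ / z₀ ∈ Complex.slitPlane := by rw [div_self hz]; exact Complex.one_mem_slitPlane
  have hd : HasDerivAt (fun z : ℂ => z / z₀) (1 / z₀) z₀ := (hasDerivAt_id z₀).div_const z₀
  refine ⟨fun z => w₀ + Complex.log (z / z₀), by simp [hz], ?_, ?_⟩
  · have := (hd.clog h1).const_add w₀
    rwa [div_self hz, div_one, one_div] at this
  · filter_upwards [hd.continuousAt.eventually (Complex.isOpen_slitPlane.mem_nhds h1)] with z hs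
    refine ⟨continuousAt_const.add (ContinuousAt.clog (by fun_prop) hs), fun w hw => ?_⟩
    have hne : z / z₀ ≠ 0 := Complex.slitPlane_ne_zero hs
    have : Complex.exp w = Complex.exp (w₀ + Complex.log (z / z₀)) := by
      rw [Complex.exp_add, Complex.exp_log hne, h, hw]
      field_simp
    exact Complex.exp_eq_exp_iff_exists_int.1 this

theorem norm_exp_real_mul {a : ℝ} {w z : ℂ} (h : Complex.exp w = z) :
    ‖Complex.exp (a * w)‖ = ‖z‖ ^ a := by
  rw [← h, Complex.norm_exp, Complex.norm_exp, ← Real.exp_mul]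
  simp [mul_comm]

namespace ClassicalFamily

/-- $K$ collects the monodromy factors, such as $e^{2\pi i n\alpha}$. Its countability later forces
a continuous choice of values to follow a single holomorphic branch. -/
theorem exists_local_branch (p : ClassicalFamily) {z₀ v₀ : ℂ} (hσ : aeval z₀ p.sigma ≠ 0)
    (hv : v₀ ∈ p.weightValues z₀) :
    ∃ (h : ℂ → ℂ) (K : Set ℂ), K.Countable ∧ h z₀ = v₀ ∧
      HasDerivAt h ((aeval z₀ p.tau - aeval z₀ (derivative p.sigma)) / aeval z₀ p.sigma * v₀) z₀ ∧
      ∀ᶠ z in 𝓝 z₀, ContinuousAt h z ∧ h z ≠ 0 ∧ ∀ v ∈ p.weightValues z, v / h z ∈ K := by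
  cases p with
  | hermite =>
    simp only [weightValues, Set.mem_singleton_iff] at hv
    refine ⟨fun z => Complex.exp (-z ^ 2), {1}, Set.countable_singleton 1, hv.symm, ?_,
      Eventually.of_forall fun z => ⟨by fun_prop, Complex.exp_ne_zero _, ?_⟩⟩
    · have := ((hasDerivAt_pow 2 z₀).neg).cexp
      rw [hv]
      refine this.congr_deriv ?_
      simp [sigma, tau]
      ring
    · rintro v rfl
      simp
  | laguerre α hα =>
    obtain ⟨w₀, hw₀, rfl⟩ := hv
    obtain ⟨L, hL, hd, hev⟩ := exists_local_log hw₀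
    refine ⟨fun z => Complex.exp (α * L z) * Complex.exp (-z),
      Set.range fun n : ℤ => Complex.exp (α * (n * (2 * Real.pi * Complex.I))),
      Set.countable_range _, by simp only [hL], ?_, ?_⟩
    · have := ((hd.const_mul (α : ℂ)).cexp).mul (hasDerivAt_neg z₀).cexp
      refine this.congr_deriv ?_
      have hz : z₀ ≠ 0 := by simpa [sigma] using hσ
      simp [sigma, tau, hL]
      field_simp
      ring
    · filter_upwards [hev] with z hz
      have hc := hz.1
      refine ⟨by fun_prop, mul_ne_zero (Complex.exp_ne_zero _) (Complex.exp_ne_zero _), ?_⟩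
      rintro v ⟨w, hw, rfl⟩
      obtain ⟨n, rfl⟩ := hz.2 w hw
      refine ⟨n, ?_⟩
      rw [mul_add, Complex.exp_add]
      field_simp [Complex.exp_ne_zero]
  | jacobi α β hα hβ =>
    obtain ⟨w₁, w₂, hw₁, hw₂, rfl⟩ := hv
    obtain ⟨L₁, hL₁, hd₁, hev₁⟩ := exists_local_log hw₁
    obtain ⟨L₂, hL₂, hd₂, hev₂⟩ := exists_local_log hw₂
    have hs₁ : HasDerivAt (fun z : ℂ => 1 - z) (-1) z₀ := (hasDerivAt_id z₀).const_sub 1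
    have hs₂ : HasDerivAt (fun z : ℂ => 1 + z) 1 z₀ := (hasDerivAt_id z₀).const_add 1
    have hev₁ := hs₁.continuousAt.eventually hev₁
    have hev₂ := hs₂.continuousAt.eventually hev₂
    refine ⟨fun z => Complex.exp (α * L₁ (1 - z)) * Complex.exp (β * L₂ (1 + z)),
      Set.range fun n : ℤ × ℤ => Complex.exp (α * (n.1 * (2 * Real.pi * Complex.I)))
        * Complex.exp (β * (n.2 * (2 * Real.pi * Complex.I))),
      Set.countable_range _, by simp only [hL₁, hL₂], ?_, ?_⟩
    · have := (((hd₁.comp z₀ hs₁).const_mul (α : ℂ)).cexp).mul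
        (((hd₂.comp z₀ hs₂).const_mul (β : ℂ)).cexp)
      refine this.congr_deriv ?_
      have h1 : 1 - z₀ ≠ 0 := hw₁ ▸ Complex.exp_ne_zero _
      have h2 : 1 + z₀ ≠ 0 := hw₂ ▸ Complex.exp_ne_zero _
      have h3 : aeval z₀ (jacobi α β hα hβ).sigma = (1 - z₀) * (1 + z₀) := by
        simp [sigma]; ring
      rw [h3]
      simp [sigma, tau, hL₁, hL₂]
      field_simp
      ring
    · filter_upwards [hev₁, hev₂] with z hz₁ hz₂
      have hc₁ : ContinuousAt (fun z => L₁ (1 - z)) z :=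
        ContinuousAt.comp (f := fun z => 1 - z) hz₁.1 (by fun_prop)
      have hc₂ : ContinuousAt (fun z => L₂ (1 + z)) z :=
        ContinuousAt.comp (f := fun z => 1 + z) hz₂.1 (by fun_prop)
      refine ⟨((continuousAt_const.mul hc₁).cexp).mul (continuousAt_const.mul hc₂).cexp, mul_ne_zero (Complex.exp_ne_zero _) (Complex.exp_ne_zero _), ?_⟩
      rintro v ⟨u₁, u₂, hu₁, hu₂, rfl⟩
      obtain ⟨n, rfl⟩ := hz₁.2 u₁ hu₁
      obtain ⟨m, rfl⟩ := hz₂.2 u₂ hu₂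
      refine ⟨(n, m), ?_⟩
      simp only [mul_add, Complex.exp_add]
      field_simp [Complex.exp_ne_zero]

/-- A continuous branch of the weight along a curve satisfies Pearson's equation. -/
theorem hasDerivAt_weight_along (p : ClassicalFamily) {z r : ℝ → ℂ} {s₀ : ℝ} {z' : ℂ}
    (hz : HasDerivAt z z' s₀) (hσ : aeval (z s₀) p.sigma ≠ 0)
    (hev : ∀ᶠ s in 𝓝 s₀, ContinuousAt z s ∧ ContinuousAt r s ∧ r s ∈ p.weightValues (z s)) :
    HasDerivAt r ((aeval (z s₀) p.tau - aeval (z s₀) (derivative p.sigma))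
      / aeval (z s₀) p.sigma * r s₀ * z') s₀ := by
  obtain ⟨h, K, hK, h0, hd, hloc⟩ := p.exists_local_branch hσ hev.self_of_nhds.2.2
  obtain ⟨ε, hε, hball⟩ := Metric.eventually_nhds_iff_ball.1
    (hev.and (hz.continuousAt.eventually hloc))
  have hne : h (z s₀) ≠ 0 := (hball s₀ (Metric.mem_ball_self hε)).2.2.1
  have hcont : ContinuousOn (fun s => r s / h (z s)) (Metric.ball s₀ ε) := fun s hs =>
    ((hball s hs).1.2.1.div (ContinuousAt.comp (hball s hs).2.1 (hball s hs).1.1)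
      (hball s hs).2.2.1).continuousWithinAt
  have hpre : IsPreconnected (Metric.ball s₀ ε) := by
    rw [Real.ball_eq_Ioo]; exact isPreconnected_Ioo
  -- The quotient $r/h(z)$ is continuous on an interval with values in a countable, hence totally
  -- disconnected, set. So it is constant, equal to its value $1$ at $s_0$.
  have hsub := hK.isTotallyDisconnected _ (Set.image_subset_iff.2 fun s hs =>
    (hball s hs).2.2.2 _ (hball s hs).1.2.2) (hpre.image _ hcont)
  have heq : r =ᶠ[𝓝 s₀] fun s => h (z s) := by
    filter_upwards [Metric.ball_mem_nhds s₀ hε] with s hs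
    have h1 := hsub (Set.mem_image_of_mem _ hs)
      (Set.mem_image_of_mem _ (Metric.mem_ball_self hε))
    simp only [h0] at h1
    rw [h0] at hne
    rw [div_self hne, div_eq_one_iff_eq (hball s hs).2.2.1] at h1
    exact h1
  exact (hd.comp s₀ hz).congr_of_eventuallyEq heq

/-- The modulus does not depend on the branch, and the exponents $k+1+\alpha$, $k+1+\beta$ are
positive since $\alpha,\beta>-1$. This controls the primitive at the branch points, where nothing is
known about $\rho$. -/
theorem exists_norm_sigma_pow_mul_weight (p : ClassicalFamily) (k : ℕ) :
    ∃ M : ℂ → ℝ, Continuous M ∧ (∀ z, aeval z p.sigma = 0 → M z = 0) ∧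
      ∀ z, ∀ v ∈ p.weightValues z, ‖(aeval z p.sigma) ^ (k + 1) * v‖ = M z := by
  have hpow : ∀ {a : ℝ} (_ : -1 < a) {z w : ℂ} (_ : Complex.exp w = z),
      ‖z‖ ^ (k + 1) * ‖Complex.exp (a * w)‖ = ‖z‖ ^ (k + 1 + a) := by
    intro a ha z w h
    have hz : 0 < ‖z‖ := by rw [← h]; exact norm_pos_iff.2 (Complex.exp_ne_zero _)
    rw [norm_exp_real_mul h, Real.rpow_add hz]
    norm_cast
  have hpos : ∀ {a : ℝ}, -1 < a → 0 < k + 1 + a := fun ha => by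
    have : (0 : ℝ) ≤ k := k.cast_nonneg
    linarith
  cases p with
  | hermite =>
    refine ⟨fun z => ‖Complex.exp (-z ^ 2)‖, by fun_prop, by simp [sigma], ?_⟩
    rintro z v rfl
    simp [sigma]
  | laguerre α hα =>
    refine ⟨fun z => ‖z‖ ^ (k + 1 + α) * ‖Complex.exp (-z)‖, ?_, ?_, ?_⟩
    · exact (continuous_norm.rpow_const fun _ => Or.inr (hpos hα).le).mul (by fun_prop)
    · intro z hz
      have : z = 0 := by simpa [sigma] using hz
      simp [this, Real.zero_rpow (hpos hα).ne']
    · rintro z v ⟨w, hw, rfl⟩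
      beta_reduce
      rw [← hpow hα hw]
      simp only [sigma, aeval_X, norm_mul, norm_pow]
      ring
  | jacobi α β hα hβ =>
    have h3 : ∀ z : ℂ, aeval z (jacobi α β hα hβ).sigma = (1 - z) * (1 + z) := fun z => by
      simp [sigma]; ring
    refine ⟨fun z => ‖1 - z‖ ^ (k + 1 + α) * ‖1 + z‖ ^ (k + 1 + β), ?_, ?_, ?_⟩
    · exact (Continuous.rpow_const (by fun_prop) fun _ => Or.inr (hpos hα).le).mul
        (Continuous.rpow_const (by fun_prop) fun _ => Or.inr (hpos hβ).le)
    · intro z hz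
      rw [h3] at hz
      rcases mul_eq_zero.1 hz with h | h
      · simp [h, Real.zero_rpow (hpos hα).ne']
      · simp [h, Real.zero_rpow (hpos hβ).ne']
    · rintro z v ⟨w₁, w₂, hw₁, hw₂, rfl⟩
      beta_reduce
      rw [← hpow hα hw₁, ← hpow hβ hw₂, h3]
      simp only [norm_mul, norm_pow]
      ring

end ClassicalFamily

/-! ### Calculus on an interval and the coordinate at infinity -/

theorem integral_Ioo_eq_zero_of_hasDerivAt_of_tendsto {a b : ℝ} (hab : a < b) {G f : ℝ → ℂ}
    {B : Set ℝ} (hB : B.Countable) (hG : ContinuousOn G (Set.Ioo a b))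
    (hd : ∀ s ∈ Set.Ioo a b \ B, HasDerivAt G (f s) s) (hf : IntegrableOn f (Set.Ioo a b))
    (ha : Tendsto G (𝓝[>] a) (𝓝 0)) (hb : Tendsto G (𝓝[<] b) (𝓝 0)) :
    ∫ s in Set.Ioo a b, f s = 0 := by
  have hc := continuousOn_Icc_extendFrom_Ioo hG ha hb
  have heq : ∀ s ∈ Set.Ioo a b, extendFrom (Set.Ioo a b) G s = G s := fun s hs =>
    extendFrom_eq (subset_closure hs) (hG s hs)
  have h := integral_eq_of_hasDerivAt_off_countable_of_le (extendFrom (Set.Ioo a b) G) f hab.le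
    hB hc (fun s hs => (hd s hs).congr_of_eventuallyEq
      (by filter_upwards [isOpen_Ioo.mem_nhds hs.1] with t ht using heq t ht))
    ((intervalIntegrable_iff_integrableOn_Ioo_of_le hab.le).2 hf)
  rw [eq_lim_at_left_extendFrom_Ioo hab ha, eq_lim_at_right_extendFrom_Ioo hab hb,
    intervalIntegral.integral_of_le hab.le, integral_Ioc_eq_integral_Ioo, sub_zero] at h
  exact h

/-- A function with integrable derivative stays within $\int|f|$ of its value at a fixed point,
however close to the ends. It serves on each side of a passage through $\infty$. -/
theorem exists_bound_of_hasDerivAt_of_integrableOn {a b u v : ℝ} (hsub : Set.Ioo u v ⊆ Set.Ioo a b)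
    {G f : ℝ → ℂ} (hd : ∀ s ∈ Set.Ioo u v, HasDerivAt G (f s) s)
    (hf : IntegrableOn f (Set.Ioo a b)) :
    ∃ C : ℝ, ∀ s ∈ Set.Ioo u v, ‖G s‖ ≤ C := by
  rcases (Set.Ioo u v).eq_empty_or_nonempty with h | ⟨c, hc⟩
  · simp [h]
  refine ⟨‖G c‖ + ∫ t in Set.Ioo a b, ‖f t‖, fun s hs => ?_⟩
  have hI : Set.uIcc c s ⊆ Set.Ioo u v := Set.ordConnected_Ioo.uIcc_subset hc hs
  have hI' : Set.uIoc c s ⊆ Set.Ioo a b := Set.uIoc_subset_uIcc.trans (hI.trans hsub)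
  have h := intervalIntegral.integral_eq_sub_of_hasDerivAt (fun t ht => hd t (hI ht))
    (intervalIntegrable_iff.2 (hf.mono_set hI'))
  have h1 : ‖G s - G c‖ ≤ ∫ t in Set.Ioo a b, ‖f t‖ := by
    rw [← h]
    exact intervalIntegral.norm_integral_le_integral_norm_uIoc.trans
      (setIntegral_mono_set hf.norm (Eventually.of_forall fun _ => norm_nonneg _)
        hI'.eventuallyLE)
  calc ‖G s‖ = ‖G c + (G s - G c)‖ := by congr 1; ring
    _ ≤ _ := (norm_add_le _ _).trans (by gcongr)

theorem Set.Finite.eventually_nhdsNE_notMem {B : Set ℝ} (hB : B.Finite) (x : ℝ) :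
    ∀ᶠ s in 𝓝[≠] x, s ∉ B := by
  filter_upwards [nhdsWithin_le_nhds ((hB.subset Set.sdiff_subset).isClosed.isOpen_compl.mem_nhds
    (show x ∈ (B \ {x})ᶜ by simp)), self_mem_nhdsWithin] with s h1 h2 h3
  exact h1 ⟨h3, h2⟩

theorem continuousAt_sphereCoord {x : OnePoint ℂ} (hx : x ≠ OnePoint.infty) :
    ContinuousAt sphereCoord x := by
  obtain ⟨z, rfl⟩ := OnePoint.ne_infty_iff_exists.1 hx
  rw [OnePoint.continuousAt_coe]
  exact continuousAt_id

theorem coe_sphereCoord {x : OnePoint ℂ} (hx : x ≠ OnePoint.infty) :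
    (sphereCoord x : OnePoint ℂ) = x := by
  obtain ⟨z, rfl⟩ := OnePoint.ne_infty_iff_exists.1 hx
  rfl

theorem tendsto_norm_sphereCoord_atTop :
    Tendsto (fun x => ‖sphereCoord x‖) (𝓝[≠] (OnePoint.infty : OnePoint ℂ)) atTop := by
  rw [OnePoint.nhdsNE_infty_eq, tendsto_map'_iff, coclosedCompact_eq_cocompact]
  exact tendsto_norm_cocompact_atTop

/-! ### The primitive along the curve and the orthogonality -/

namespace ClassicalFamily

variable (p : ClassicalFamily) {k : ℕ} (i : Fin k → ℕ) {γ : ℝ → OnePoint ℂ} {a b : ℝ} {ρ : ℂ → ℂ}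

/-- The function `σ^(k+1) ρ A / q` along the curve `γ`, extended by `0` to the point `∞`. -/
noncomputable def weightedPrimitive (γ : ℝ → OnePoint ℂ) (ρ : ℂ → ℂ) (A : ℝ[X]) (s : ℝ) : ℂ :=
  open Classical in
  if γ s = OnePoint.infty then 0 else
    (aeval (sphereCoord (γ s)) p.sigma) ^ (k + 1) * ρ (sphereCoord (γ s))
      * aeval (sphereCoord (γ s)) A / aeval (sphereCoord (γ s)) (p.q i)

theorem weightedPrimitive_of_ne {s : ℝ} (h : γ s ≠ OnePoint.infty) (A : ℝ[X]) :
    p.weightedPrimitive i γ ρ A s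
      = (aeval (sphereCoord (γ s)) p.sigma) ^ (k + 1) * ρ (sphereCoord (γ s))
        * aeval (sphereCoord (γ s)) A / aeval (sphereCoord (γ s)) (p.q i) :=
  if_neg h

/-- The parameters at which the curve is at infinity or at a zero of `σ`. -/
def singularParameters (γ : ℝ → OnePoint ℂ) (a b : ℝ) : Set ℝ :=
  {s ∈ Set.Ioo a b | γ s = OnePoint.infty ∨ aeval (sphereCoord (γ s)) p.sigma = 0}

theorem sigma_ne_zero : p.sigma ≠ 0 := by
  intro h
  have h2 := congrArg (eval 2) h
  cases p <;> norm_num [sigma] at h2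

/-- The curve is simple, so it meets $\infty$ and each of the finitely many zeros of $\sigma$ at
most once in its interior. -/
theorem finite_singularParameters (hγ : IsSimplePiecewiseSmooth γ a b) :
    (p.singularParameters γ a b).Finite := by
  refine Set.Finite.of_finite_image (f := γ) ?_
    (hγ.injOn_Ico.mono fun s hs => Set.Ioo_subset_Ico_self hs.1)
  refine (((p.sigma.rootSet_finite ℂ).image ((↑) : ℂ → OnePoint ℂ)).insert
    OnePoint.infty).subset ?_
  rintro _ ⟨s, ⟨hs, h⟩, rfl⟩
  by_cases hs' : γ s = OnePoint.infty
  · exact Or.inl hs'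
  · refine Or.inr ⟨sphereCoord (γ s), ?_, coe_sphereCoord hs'⟩
    exact mem_rootSet.2 ⟨p.sigma_ne_zero, h.resolve_left hs'⟩

theorem continuousAt_curve (hγ : IsSimplePiecewiseSmooth γ a b) {s : ℝ} (hs : s ∈ Set.Ioo a b) :
    ContinuousAt γ s :=
  hγ.continuousOn.continuousAt (Icc_mem_nhds hs.1 hs.2)

theorem continuousAt_sphereCoord_curve (hγ : IsSimplePiecewiseSmooth γ a b) {s : ℝ}
    (hs : s ∈ Set.Ioo a b) (h : γ s ≠ OnePoint.infty) :
    ContinuousAt (fun t => sphereCoord (γ t)) s :=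
  ContinuousAt.comp (continuousAt_sphereCoord h) (continuousAt_curve hγ hs)

theorem eventually_ne_infty (hγ : IsSimplePiecewiseSmooth γ a b) {s : ℝ}
    (hs : s ∈ Set.Ioo a b) (h : γ s ≠ OnePoint.infty) :
    ∀ᶠ t in 𝓝 s, t ∈ Set.Ioo a b ∧ γ t ≠ OnePoint.infty := by
  filter_upwards [Ioo_mem_nhds hs.1 hs.2, (continuousAt_curve hγ hs).eventually_ne h]
    with t h1 h2 using ⟨h1, h2⟩

theorem eventually_regular (hγ : IsSimplePiecewiseSmooth γ a b) {s : ℝ}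
    (hs : s ∈ Set.Ioo a b) (h : γ s ≠ OnePoint.infty)
    (hσ : aeval (sphereCoord (γ s)) p.sigma ≠ 0) :
    ∀ᶠ t in 𝓝 s, t ∈ Set.Ioo a b ∧ γ t ≠ OnePoint.infty ∧
      aeval (sphereCoord (γ t)) p.sigma ≠ 0 := by
  have hc : ContinuousAt (fun t => aeval (sphereCoord (γ t)) p.sigma) s :=
    ContinuousAt.comp (g := fun z : ℂ => aeval z p.sigma) p.sigma.continuous_aeval.continuousAt
      (continuousAt_sphereCoord_curve hγ hs h)
  filter_upwards [eventually_ne_infty hγ hs h, hc.eventually_ne hσ] with t h1 h2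
  exact ⟨h1.1, h1.2, h2⟩

theorem sphereCoord_mem_curveInterior {s : ℝ} (hs : s ∈ Set.Ioo a b)
    (h : γ s ≠ OnePoint.infty) : sphereCoord (γ s) ∈ curveInterior γ a b :=
  ⟨s, hs, (coe_sphereCoord h).symm⟩

theorem continuousAt_weight_curve (hγ : IsSimplePiecewiseSmooth γ a b)
    (hρ : p.IsWeightBranch ρ (curveInterior γ a b)) {s : ℝ}
    (hs : s ∈ Set.Ioo a b) (h : γ s ≠ OnePoint.infty)
    (hσ : aeval (sphereCoord (γ s)) p.sigma ≠ 0) :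
    ContinuousAt (fun t => ρ (sphereCoord (γ t))) s := by
  refine Tendsto.comp (hρ.1 _ ⟨sphereCoord_mem_curveInterior hs h, hσ⟩)
    (tendsto_nhdsWithin_iff.2 ⟨continuousAt_sphereCoord_curve hγ hs h, ?_⟩)
  filter_upwards [p.eventually_regular hγ hs h hσ] with t ht
  exact ⟨sphereCoord_mem_curveInterior ht.1 ht.2.1, ht.2.2⟩

theorem hasDerivAt_aeval_comp (A : ℝ[X]) {z : ℝ → ℂ} {z' : ℂ} {s : ℝ} (hz : HasDerivAt z z' s) :
    HasDerivAt (fun t => aeval (z t) A) (aeval (z s) (derivative A) * z') s :=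
  (A.hasDerivAt_aeval (z s)).comp s hz

/-- Pearson's equation lowers the term $(k+1)\sigma'$ to $k\sigma'+\tau$; the factor that remains is
exactly $\tilde\rho$. -/
theorem hasDerivAt_weightedPrimitive (hγ : IsSimplePiecewiseSmooth γ a b)
    (hq : ∀ s ∈ Set.Icc a b, ∀ z : ℂ, γ s = (z : OnePoint ℂ) → aeval z (p.q i) ≠ 0)
    (hρ : p.IsWeightBranch ρ (curveInterior γ a b)) (A : ℝ[X]) {s : ℝ} (hs : s ∈ Set.Ioo a b)
    (hd : DifferentiableAt ℝ (fun t => sphereCoord (γ t)) s)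
    (hsing : s ∉ p.singularParameters γ a b) :
    HasDerivAt (p.weightedPrimitive i γ ρ A)
      (lineIntegrand γ (fun z => aeval z (p.primitiveNumerator i A) * p.tildeWeight i ρ z) s) s := by
  have hs' : γ s ≠ OnePoint.infty ∧ aeval (sphereCoord (γ s)) p.sigma ≠ 0 := by
    constructor <;> intro h <;> exact hsing ⟨hs, by simp [h]⟩
  obtain ⟨hinf, hσ⟩ := hs'
  have hz := hd.hasDerivAt
  have hr := p.hasDerivAt_weight_along (r := fun t => ρ (sphereCoord (γ t))) hz hσ (by
    filter_upwards [p.eventually_regular hγ hs hinf hσ] with t ht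
    exact ⟨continuousAt_sphereCoord_curve hγ ht.1 ht.2.1,
      p.continuousAt_weight_curve hγ hρ ht.1 ht.2.1 ht.2.2,
      hρ.2 _ (sphereCoord_mem_curveInterior ht.1 ht.2.1) ht.2.2⟩)
  have hq0 := hq s (Set.Ioo_subset_Icc_self hs) _ (coe_sphereCoord hinf).symm
  have hmain := ((((hasDerivAt_aeval_comp p.sigma hz).pow (k + 1)).mul hr).mul
    (hasDerivAt_aeval_comp A hz)).div (hasDerivAt_aeval_comp (p.q i) hz) hq0
  refine (hmain.congr_of_eventuallyEq ?_).congr_deriv ?_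
  · filter_upwards [eventually_ne_infty hγ hs hinf] with t ht
    exact p.weightedPrimitive_of_ne i ht.2 A
  · simp only [lineIntegrand, primitiveNumerator, tildeWeight, map_sub, map_mul, map_add,
      map_natCast, Pi.mul_apply, Pi.pow_apply, Nat.add_sub_cancel]
    push_cast
    field_simp
    ring

theorem norm_sphereCoord_mul_norm_weightedPrimitive {s : ℝ} (h : γ s ≠ OnePoint.infty)
    (A : ℝ[X]) : ‖p.weightedPrimitive i γ ρ (X * A) s‖
      = ‖sphereCoord (γ s)‖ * ‖p.weightedPrimitive i γ ρ A s‖ := by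
  rw [p.weightedPrimitive_of_ne i h, p.weightedPrimitive_of_ne i h, ← norm_mul, map_mul, aeval_X]
  congr 1
  ring

theorem lineIntegrable_aeval_mul_tildeWeight
    (hint : ∀ n : ℕ, LineIntegrable γ a b fun z => z ^ n * p.tildeWeight i ρ z) (A : ℝ[X]) :
    LineIntegrable γ a b fun z => aeval z A * p.tildeWeight i ρ z := by
  have : lineIntegrand γ (fun z => aeval z A * p.tildeWeight i ρ z)
      = fun s => ∑ n ∈ Finset.range (A.natDegree + 1),
        (A.coeff n : ℂ) * lineIntegrand γ (fun z => z ^ n * p.tildeWeight i ρ z) s := by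
    ext1 s
    simp only [lineIntegrand, aeval_eq_sum_range, Finset.sum_mul]
    refine Finset.sum_congr rfl fun n _ => ?_
    rw [Complex.real_smul]
    ring
  unfold LineIntegrable
  rw [this]
  exact integrable_finsetSum _ fun n _ => (hint n).const_mul _

/-- Near a parameter where the curve runs through infinity, the primitive tends to zero. -/
theorem continuousAt_weightedPrimitive_of_eq_infty (hγ : IsSimplePiecewiseSmooth γ a b)
    (hq : ∀ s ∈ Set.Icc a b, ∀ z : ℂ, γ s = (z : OnePoint ℂ) → aeval z (p.q i) ≠ 0)
    (hρ : p.IsWeightBranch ρ (curveInterior γ a b))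
    (hint : ∀ n : ℕ, LineIntegrable γ a b fun z => z ^ n * p.tildeWeight i ρ z)
    (A : ℝ[X]) {s : ℝ} (hs : s ∈ Set.Ioo a b) (hinf : γ s = OnePoint.infty) :
    ContinuousAt (p.weightedPrimitive i γ ρ A) s := by
  obtain ⟨F, hF⟩ := hγ.smooth
  have hev := ((p.finite_singularParameters hγ).union
    F.finite_toSet).eventually_nhdsNE_notMem s
  obtain ⟨ε, hε, hball⟩ := Metric.eventually_nhds_iff_ball.1
    ((eventually_nhdsWithin_iff.1 hev).and (isOpen_Ioo.mem_nhds hs))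
  rw [Real.ball_eq_Ioo] at hball
  -- One spare power of $z$: the primitive built from $XA$ is bounded on each side of $s$, so the
  -- one built from $A$ is $O(1/|z|)$ and tends to $0$.
  have hbd : ∀ u v, Set.Ioo u v ⊆ Set.Ioo (s - ε) (s + ε) → s ∉ Set.Ioo u v →
      ∃ C : ℝ, ∀ t ∈ Set.Ioo u v, ‖p.weightedPrimitive i γ ρ (X * A) t‖ ≤ C := by
    intro u v hsub hne
    refine exists_bound_of_hasDerivAt_of_integrableOn (fun t ht => (hball t (hsub ht)).2)
      (fun t ht => ?_) (p.lineIntegrable_aeval_mul_tildeWeight i hint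
        (p.primitiveNumerator i (X * A)))
    have h1 := (hball t (hsub ht)).1 (by rintro rfl; exact hne ht)
    have h2 := (hball t (hsub ht)).2
    exact p.hasDerivAt_weightedPrimitive i hγ hq hρ _ h2
      ((hF t h2 fun h => h1 (Or.inr h)).2.differentiableAt (by norm_num)) fun h => h1 (Or.inl h)
  obtain ⟨C₁, hC₁⟩ := hbd (s - ε) s (Set.Ioo_subset_Ioo_right (by linarith)) (by simp)
  obtain ⟨C₂, hC₂⟩ := hbd s (s + ε) (Set.Ioo_subset_Ioo_left (by linarith)) (by simp)
  have hne : ∀ᶠ t in 𝓝[≠] s, γ t ≠ OnePoint.infty := by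
    filter_upwards [hev, nhdsWithin_le_nhds (isOpen_Ioo.mem_nhds hs)] with t ht ht' h
    exact ht (Or.inl ⟨ht', Or.inl h⟩)
  have hz : Tendsto (fun t => ‖sphereCoord (γ t)‖) (𝓝[≠] s) atTop := by
    refine tendsto_norm_sphereCoord_atTop.comp (tendsto_nhdsWithin_iff.2 ⟨?_, hne⟩)
    rw [← hinf]
    exact (continuousAt_curve hγ hs).tendsto.mono_left nhdsWithin_le_nhds
  have h0 : p.weightedPrimitive i γ ρ A s = 0 := if_pos hinf
  rw [continuousAt_iff_punctured_nhds, h0]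
  refine squeeze_zero_norm' ?_ (hz.const_div_atTop (max C₁ C₂))
  filter_upwards [hne, hz.eventually_gt_atTop 0, self_mem_nhdsWithin,
    nhdsWithin_le_nhds (Ioo_mem_nhds (show s - ε < s by linarith) (show s < s + ε by linarith))]
    with t h1 h2 h3 h4
  rw [le_div_iff₀ h2, mul_comm, ← p.norm_sphereCoord_mul_norm_weightedPrimitive i h1]
  rcases lt_or_gt_of_ne h3 with h | h
  · exact (hC₁ t ⟨h4.1, h⟩).trans (le_max_left _ _)
  · exact (hC₂ t ⟨h, h4.2⟩).trans (le_max_right _ _)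

theorem continuousAt_weightedPrimitive (hγ : IsSimplePiecewiseSmooth γ a b)
    (hq : ∀ s ∈ Set.Icc a b, ∀ z : ℂ, γ s = (z : OnePoint ℂ) → aeval z (p.q i) ≠ 0)
    (hρ : p.IsWeightBranch ρ (curveInterior γ a b))
    (hint : ∀ n : ℕ, LineIntegrable γ a b fun z => z ^ n * p.tildeWeight i ρ z)
    (A : ℝ[X]) {s : ℝ} (hs : s ∈ Set.Ioo a b) :
    ContinuousAt (p.weightedPrimitive i γ ρ A) s := by
  by_cases hinf : γ s = OnePoint.infty
  · exact p.continuousAt_weightedPrimitive_of_eq_infty i hγ hq hρ hint A hs hinf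
  have hz := continuousAt_sphereCoord_curve hγ hs hinf
  have hpoly : ∀ Q : ℝ[X], ContinuousAt (fun t => aeval (sphereCoord (γ t)) Q) s := fun Q =>
    ContinuousAt.comp (g := fun z : ℂ => aeval z Q) Q.continuous_aeval.continuousAt hz
  have hq0 := hq s (Set.Ioo_subset_Icc_self hs) _ (coe_sphereCoord hinf).symm
  by_cases hσ : aeval (sphereCoord (γ s)) p.sigma = 0
  · obtain ⟨M, hMc, hM0, hM⟩ := p.exists_norm_sigma_pow_mul_weight k
    have h0 : p.weightedPrimitive i γ ρ A s = 0 := by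
      rw [p.weightedPrimitive_of_ne i hinf, hσ]
      simp
    have hlim : Tendsto (fun t => M (sphereCoord (γ t)) *
        ‖aeval (sphereCoord (γ t)) A / aeval (sphereCoord (γ t)) (p.q i)‖) (𝓝 s) (𝓝 0) := by
      have hc : ContinuousAt (fun t => M (sphereCoord (γ t)) *
          ‖aeval (sphereCoord (γ t)) A / aeval (sphereCoord (γ t)) (p.q i)‖) s :=
        (ContinuousAt.comp hMc.continuousAt hz).mul ((hpoly A).div (hpoly (p.q i)) hq0).norm
      have := hc.tendsto
      rwa [hM0 _ hσ, zero_mul] at this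
    rw [ContinuousAt, h0]
    refine squeeze_zero_norm' ?_ hlim
    filter_upwards [eventually_ne_infty hγ hs hinf] with t ht
    rw [p.weightedPrimitive_of_ne i ht.2, mul_div_assoc, norm_mul]
    refine mul_le_mul_of_nonneg_right (le_of_eq ?_) (norm_nonneg _)
    by_cases hσt : aeval (sphereCoord (γ t)) p.sigma = 0
    · rw [hM0 _ hσt, hσt]
      simp
    · exact hM _ _ (hρ.2 _ (sphereCoord_mem_curveInterior ht.1 ht.2) hσt)
  · refine ContinuousAt.congr (f := fun t => (aeval (sphereCoord (γ t)) p.sigma) ^ (k + 1)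
      * ρ (sphereCoord (γ t)) * aeval (sphereCoord (γ t)) A
      / aeval (sphereCoord (γ t)) (p.q i)) ?_ ?_
    · exact ((((hpoly _).pow _).mul (p.continuousAt_weight_curve hγ hρ hs hinf hσ)).mul
        (hpoly A)).div (hpoly _) hq0
    · filter_upwards [eventually_ne_infty hγ hs hinf] with t ht
      exact (p.weightedPrimitive_of_ne i ht.2 A).symm

/-- Since $\sigma^{k+1}\rho A/q=\tilde\rho\,\sigma\cdot qA$ and $qA$ is a polynomial, the primitive
is a finite combination of the quantities assumed to vanish. -/
theorem tendsto_weightedPrimitive_zero {l : Filter ℝ}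
    (hlim : ∀ n : ℕ, Tendsto (fun s => p.tildeWeight i ρ (sphereCoord (γ s)) *
      aeval (sphereCoord (γ s)) p.sigma * sphereCoord (γ s) ^ n) l (𝓝 0))
    (hne : ∀ᶠ s in l, γ s ≠ OnePoint.infty ∧ aeval (sphereCoord (γ s)) (p.q i) ≠ 0) (A : ℝ[X]) :
    Tendsto (p.weightedPrimitive i γ ρ A) l (𝓝 0) := by
  have h : Tendsto (fun s => ∑ n ∈ Finset.range ((p.q i * A).natDegree + 1),
      ((p.q i * A).coeff n : ℂ) * (p.tildeWeight i ρ (sphereCoord (γ s)) *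
        aeval (sphereCoord (γ s)) p.sigma * sphereCoord (γ s) ^ n)) l (𝓝 0) := by
    rw [← Finset.sum_const_zero (s := Finset.range ((p.q i * A).natDegree + 1))]
    refine tendsto_finsetSum _ fun n _ => ?_
    simpa using (hlim n).const_mul ((p.q i * A).coeff n : ℂ)
  refine h.congr' ?_
  filter_upwards [hne] with s hs
  have hsum : ∑ n ∈ Finset.range ((p.q i * A).natDegree + 1),
      ((p.q i * A).coeff n : ℂ) * (p.tildeWeight i ρ (sphereCoord (γ s)) *
        aeval (sphereCoord (γ s)) p.sigma * sphereCoord (γ s) ^ n)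
      = p.tildeWeight i ρ (sphereCoord (γ s)) * aeval (sphereCoord (γ s)) p.sigma
        * aeval (sphereCoord (γ s)) (p.q i * A) := by
    rw [aeval_eq_sum_range (p := p.q i * A), Finset.mul_sum]
    refine Finset.sum_congr rfl fun n _ => ?_
    rw [Complex.real_smul]
    ring
  rw [hsum, p.weightedPrimitive_of_ne i hs.1, map_mul, tildeWeight]
  have := hs.2
  field_simp
  ring

theorem lineIntegral_primitiveNumerator (hγ : IsSimplePiecewiseSmooth γ a b)
    (hq : ∀ s ∈ Set.Icc a b, ∀ z : ℂ, γ s = (z : OnePoint ℂ) → aeval z (p.q i) ≠ 0)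
    (hρ : p.IsWeightBranch ρ (curveInterior γ a b))
    (hint : ∀ n : ℕ, LineIntegrable γ a b fun z => z ^ n * p.tildeWeight i ρ z)
    (hla : ∀ n : ℕ, Tendsto (fun s => p.tildeWeight i ρ (sphereCoord (γ s)) *
      aeval (sphereCoord (γ s)) p.sigma * sphereCoord (γ s) ^ n) (𝓝[>] a) (𝓝 0))
    (hlb : ∀ n : ℕ, Tendsto (fun s => p.tildeWeight i ρ (sphereCoord (γ s)) *
      aeval (sphereCoord (γ s)) p.sigma * sphereCoord (γ s) ^ n) (𝓝[<] b) (𝓝 0)) (A : ℝ[X]) :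
    lineIntegral γ a b
      (fun z => aeval z (p.primitiveNumerator i A) * p.tildeWeight i ρ z) = 0 := by
  obtain ⟨F, hF⟩ := hγ.smooth
  have hfin := p.finite_singularParameters hγ
  have hne : ∀ s ∈ Set.Ioo a b, s ∉ p.singularParameters γ a b →
      γ s ≠ OnePoint.infty ∧ aeval (sphereCoord (γ s)) (p.q i) ≠ 0 := by
    intro s hs h
    have hinf : γ s ≠ OnePoint.infty := fun h' => h ⟨hs, Or.inl h'⟩
    exact ⟨hinf, hq s (Set.Ioo_subset_Icc_self hs) _ (coe_sphereCoord hinf).symm⟩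
  refine integral_Ioo_eq_zero_of_hasDerivAt_of_tendsto hγ.lt
    (hfin.union F.finite_toSet).countable
    (fun s hs => (p.continuousAt_weightedPrimitive i hγ hq hρ hint A hs).continuousWithinAt)
    (fun s hs => p.hasDerivAt_weightedPrimitive i hγ hq hρ A hs.1
      ((hF s hs.1 fun h => hs.2 (Or.inr h)).2.differentiableAt (by norm_num))
      fun h => hs.2 (Or.inl h))
    (p.lineIntegrable_aeval_mul_tildeWeight i hint _)
    (p.tendsto_weightedPrimitive_zero i hla ?_ A) (p.tendsto_weightedPrimitive_zero i hlb ?_ A)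
  · filter_upwards [Ioo_mem_nhdsGT hγ.lt, nhdsWithin_mono _ (fun s hs => ne_of_gt hs)
      (hfin.eventually_nhdsNE_notMem a)] with s h1 h2
    exact hne s h1 h2
  · filter_upwards [Ioo_mem_nhdsLT hγ.lt, nhdsWithin_mono _ (fun s hs => ne_of_lt hs)
      (hfin.eventually_nhdsNE_notMem b)] with s h1 h2
    exact hne s h1 h2

theorem orthogonal_on_curve (hγ : IsSimplePiecewiseSmooth γ a b)
    (hq : ∀ s ∈ Set.Icc a b, ∀ z : ℂ, γ s = (z : OnePoint ℂ) → aeval z (p.q i) ≠ 0)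
    (hρ : p.IsWeightBranch ρ (curveInterior γ a b))
    (hint : ∀ n : ℕ, LineIntegrable γ a b fun z => z ^ n * p.tildeWeight i ρ z)
    (hla : ∀ n : ℕ, Tendsto (fun s => p.tildeWeight i ρ (sphereCoord (γ s)) *
      aeval (sphereCoord (γ s)) p.sigma * sphereCoord (γ s) ^ n) (𝓝[>] a) (𝓝 0))
    (hlb : ∀ n : ℕ, Tendsto (fun s => p.tildeWeight i ρ (sphereCoord (γ s)) *
      aeval (sphereCoord (γ s)) p.sigma * sphereCoord (γ s) ^ n) (𝓝[<] b) (𝓝 0))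
    {l n : ℕ} (hln : l ≠ n) :
    LineIntegrable γ a b
        (fun z => aeval z (p.P i l) * aeval z (p.P i n) * p.tildeWeight i ρ z) ∧
      lineIntegral γ a b
        (fun z => aeval z (p.P i l) * aeval z (p.P i n) * p.tildeWeight i ρ z) = 0 := by
  constructor
  · simpa only [map_mul] using p.lineIntegrable_aeval_mul_tildeWeight i hint (p.P i l * p.P i n)
  · obtain ⟨V, hV⟩ := p.exists_primitiveNumerator_eq i l n
    have h := p.lineIntegral_primitiveNumerator i hγ hq hρ hint hla hlb V
    have hconst : lineIntegral γ a b
        (fun z => aeval z (p.primitiveNumerator i V) * p.tildeWeight i ρ z)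
        = ((p.eigenvalue l - p.eigenvalue n : ℝ) : ℂ) * lineIntegral γ a b
          (fun z => aeval z (p.P i l) * aeval z (p.P i n) * p.tildeWeight i ρ z) := by
      unfold lineIntegral
      rw [← integral_const_mul]
      refine integral_congr_ae (Eventually.of_forall fun s => ?_)
      simp only [lineIntegrand, hV, map_mul, aeval_C, Complex.coe_algebraMap]
      ring
    rw [hconst] at h
    refine (mul_eq_zero.1 h).resolve_left ?_
    exact_mod_cast sub_ne_zero.2 (p.eigenvalue_injective.ne hln)

end ClassicalFamily

/-! ### The Laguerre example on the half-line -/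

namespace ClassicalFamily

theorem laguerre_q_one_two_eval (α : ℝ) (hα : -1 < α) (x : ℝ) :
    ((laguerre α hα).q ![1, 2]).eval x = -((x - (α + 1)) ^ 2 + (α + 1)) / 2 := by
  have h1 : laguerreL α 1 = C (α + 1) - X := by
    simp [laguerreL, Finset.sum_range_succ, sub_eq_add_neg]
  have h2 : laguerreL α 2 = C ((α + 1) * (α + 2) / 2) - C (α + 2) * X + C (1 / 2) * X ^ 2 := by
    simp only [laguerreL, Finset.sum_range_succ, Finset.sum_range_zero, ascPochhammer_succ_eval,
      ascPochhammer_zero, eval_one, Nat.factorial]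
    rw [zero_add]
    norm_num [ascPochhammer_succ_eval]
    simp only [C_mul, C_add, div_eq_mul_inv, C_1, show (C 2 : ℝ[X]) = 2 from rfl]
    ring_nf
  simp only [q, wronskianDet, poly, Matrix.det_fin_two, Matrix.of_apply, Fin.val_zero, Fin.val_one,
    Function.iterate_zero, Function.iterate_one, id, Matrix.cons_val_zero, Matrix.cons_val_one, h1, h2]
  simp
  ring

/-- A uniform negative bound gives more than the absence of zeros: it makes $1/q$ bounded, so
integrability and decay reduce to those of $x^ce^{-x}$ times a polynomial. -/
theorem laguerre_q_one_two_eval_le (α : ℝ) (hα : -1 < α) (x : ℝ) :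
    ((laguerre α hα).q ![1, 2]).eval x ≤ -((α + 1) / 2) := by
  rw [laguerre_q_one_two_eval]
  nlinarith [sq_nonneg (x - (α + 1))]

theorem integrableOn_eval_mul_rpow_mul_exp (A : ℝ[X]) {c : ℝ} (hc : -1 < c) :
    IntegrableOn (fun x : ℝ => A.eval x * (x ^ c * Real.exp (-x))) (Set.Ioi 0) := by
  have : ∀ n : ℕ, IntegrableOn (fun x : ℝ => x ^ n * (x ^ c * Real.exp (-x))) (Set.Ioi 0) := by
    intro n
    have hpos : 0 < n + c + 1 := by
      have : (0 : ℝ) ≤ n := n.cast_nonneg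
      linarith
    refine (Real.GammaIntegral_convergent hpos).congr_fun (fun x hx => ?_) measurableSet_Ioi
    have hx : 0 < x := hx
    simp only [add_sub_cancel_right]
    rw [Real.rpow_add hx, Real.rpow_natCast]
    ring
  simp_rw [eval_eq_sum_range, Finset.sum_mul, mul_assoc]
  exact integrable_finsetSum _ fun n _ => (this n).const_mul _

theorem tendsto_eval_mul_rpow_mul_exp_atTop (A : ℝ[X]) (c : ℝ) :
    Tendsto (fun x : ℝ => A.eval x * (x ^ c * Real.exp (-x))) atTop (𝓝 0) := by
  have : ∀ n : ℕ, Tendsto (fun x : ℝ => x ^ n * (x ^ c * Real.exp (-x))) atTop (𝓝 0) := by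
    intro n
    refine (tendsto_rpow_mul_exp_neg_mul_atTop_nhds_zero (n + c) 1 one_pos).congr' ?_
    filter_upwards [eventually_gt_atTop 0] with x hx
    rw [Real.rpow_add hx, Real.rpow_natCast]
    ring_nf
  simp_rw [eval_eq_sum_range, Finset.sum_mul, mul_assoc]
  rw [← Finset.sum_const_zero (s := Finset.range (A.natDegree + 1))]
  exact tendsto_finsetSum _ fun n _ => by simpa using (this n).const_mul (A.coeff n)

theorem laguerre_one_two_orthogonal (α : ℝ) (hα : -1 < α) {l n : ℕ} (hln : l ≠ n) :
    IntegrableOn (fun x : ℝ => ((laguerre α hα).P ![1, 2] l).eval x *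
        ((laguerre α hα).P ![1, 2] n).eval x *
        (x ^ (α + 2) * Real.exp (-x) / (((laguerre α hα).q ![1, 2]).eval x) ^ 2)) (Set.Ioi 0) ∧
      ∫ x in Set.Ioi (0 : ℝ), ((laguerre α hα).P ![1, 2] l).eval x *
        ((laguerre α hα).P ![1, 2] n).eval x *
        (x ^ (α + 2) * Real.exp (-x) / (((laguerre α hα).q ![1, 2]).eval x) ^ 2) = 0 := by
  set p := laguerre α hα with hp
  set Q := p.q ![1, 2] with hQ
  have hα' : 0 < (α + 1) / 2 := by linarith
  have hQle : ∀ x, Q.eval x ≤ -((α + 1) / 2) := laguerre_q_one_two_eval_le α hα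
  have hQ0 : ∀ x, Q.eval x ≠ 0 := fun x => ((hQle x).trans_lt (by linarith)).ne
  have hQinv : ∀ x, ‖(Q.eval x)⁻¹‖ ≤ ((α + 1) / 2)⁻¹ := by
    intro x
    rw [norm_inv, Real.norm_eq_abs]
    gcongr
    rw [abs_of_neg ((hQle x).trans_lt (by linarith))]
    linarith [hQle x]
  have hQcont : Continuous fun x => (Q.eval x)⁻¹ := Q.continuous.inv₀ hQ0
  have hint : ∀ A : ℝ[X], IntegrableOn (fun x : ℝ => A.eval x *
      (x ^ (α + 2) * Real.exp (-x) / (Q.eval x) ^ 2)) (Set.Ioi 0) := by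
    intro A
    have h := (integrableOn_eval_mul_rpow_mul_exp A (c := α + 2) (by linarith)).bdd_mul
      (c := ((α + 1) / 2)⁻¹ ^ 2) (f := fun x => (Q.eval x)⁻¹ ^ 2)
      (hQcont.pow 2).aestronglyMeasurable
      (Eventually.of_forall fun x => by rw [norm_pow]; gcongr; exact hQinv x)
    refine h.congr (Eventually.of_forall fun x => ?_)
    simp only [div_eq_mul_inv, inv_pow]
    ring
  -- The same primitive with $k=2$: $\sigma^{k+1}\rho=x^{\alpha+3}e^{-x}$. On the positive axis the
  -- real power needs no choice of branch.
  have hderiv : ∀ A : ℝ[X], ∀ x ∈ Set.Ioi (0 : ℝ),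
      HasDerivAt (fun x : ℝ => x ^ (α + 3) * Real.exp (-x) * A.eval x / Q.eval x)
        ((p.primitiveNumerator ![1, 2] A).eval x
          * (x ^ (α + 2) * Real.exp (-x) / (Q.eval x) ^ 2)) x := by
    intro A x hx
    have hx : 0 < x := hx
    have h := ((((Real.hasDerivAt_rpow_const (p := α + 3) (Or.inl hx.ne')).mul
      (hasDerivAt_neg x).exp).mul (A.hasDerivAt x)).div (Q.hasDerivAt x) (hQ0 x))
    refine h.congr_deriv ?_
    have h1 : x ^ (α + 3) = x ^ (α + 2) * x := by
      rw [show α + 3 = α + 2 + 1 by ring, Real.rpow_add_one hx.ne']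
    have h2 : x ^ (α + 3 - 1) = x ^ (α + 2) := by congr 1; ring
    have := hQ0 x
    simp only [primitiveNumerator, hp, sigma, tau, Pi.mul_apply, h1, h2]
    simp only [eval_sub, eval_mul, eval_add, eval_X, eval_C, derivative_X, eval_one, eval_natCast]
    field_simp
    push_cast
    ring
  refine ⟨by simpa only [eval_mul] using hint (p.P ![1, 2] l * p.P ![1, 2] n), ?_⟩
  obtain ⟨V, hV⟩ := p.exists_primitiveNumerator_eq ![1, 2] l n
  have hcont : ContinuousWithinAt
      (fun x : ℝ => x ^ (α + 3) * Real.exp (-x) * V.eval x / Q.eval x) (Set.Ici 0) 0 := by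
    refine ContinuousAt.continuousWithinAt ?_
    exact (((Real.continuousAt_rpow_const 0 (α + 3) (Or.inr (by linarith))).mul
      (by fun_prop)).mul V.continuous.continuousAt).div Q.continuous.continuousAt (hQ0 0)
  have htop : Tendsto (fun x : ℝ => x ^ (α + 3) * Real.exp (-x) * V.eval x / Q.eval x) atTop
      (𝓝 0) := by
    have h := (tendsto_eval_mul_rpow_mul_exp_atTop V (α + 3)).norm.mul_const (((α + 1) / 2)⁻¹)
    rw [norm_zero, zero_mul] at h
    refine squeeze_zero_norm (fun x => ?_) h
    rw [div_eq_mul_inv, norm_mul, mul_comm (_ * _) (V.eval x)]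
    gcongr
    exact hQinv x
  have h := integral_Ioi_of_hasDerivAt_of_tendsto hcont (hderiv V) (hint _) htop
  -- The boundary term at $0$ vanishes because $\alpha+3>0$.
  rw [Real.zero_rpow (by linarith), zero_mul, zero_mul, zero_div, sub_zero, hV] at h
  simp only [eval_mul, eval_C, mul_assoc] at h
  rw [integral_const_mul] at h
  simp only [mul_assoc]
  exact (mul_eq_zero.1 h).resolve_left (sub_ne_zero.2 (p.eigenvalue_injective.ne hln))

end ClassicalFamily

theorem theorem2 :
    -- The orthogonality theorem for all families, index sequences and curves.
    (∀ (p : ClassicalFamily) (k : ℕ) (i : Fin k → ℕ), Function.Injective i →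
      ∀ (γ : ℝ → OnePoint ℂ) (a b : ℝ), IsSimplePiecewiseSmooth γ a b →
      (∀ s ∈ Set.Icc a b, ∀ z : ℂ, γ s = (z : OnePoint ℂ) → aeval z (p.q i) ≠ 0) →
      ∀ ρ : ℂ → ℂ, p.IsWeightBranch ρ (curveInterior γ a b) →
      (∀ n : ℕ, LineIntegrable γ a b fun z => z ^ n * p.tildeWeight i ρ z) →
      (∀ n : ℕ, Tendsto (fun s => p.tildeWeight i ρ (sphereCoord (γ s)) *
          aeval (sphereCoord (γ s)) p.sigma * sphereCoord (γ s) ^ n) (𝓝[>] a) (𝓝 0)) →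
      (∀ n : ℕ, Tendsto (fun s => p.tildeWeight i ρ (sphereCoord (γ s)) *
          aeval (sphereCoord (γ s)) p.sigma * sphereCoord (γ s) ^ n) (𝓝[<] b) (𝓝 0)) →
      ∀ l n : ℕ, l ∉ Set.range i → n ∉ Set.range i → l ≠ n →
        LineIntegrable γ a b
            (fun z => aeval z (p.P i l) * aeval z (p.P i n) * p.tildeWeight i ρ z) ∧
          lineIntegral γ a b
            (fun z => aeval z (p.P i l) * aeval z (p.P i n) * p.tildeWeight i ρ z) = 0) ∧
    -- The example `W[L_1, L_2, L_m]` on `[0, ∞)`.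
    (∀ (α : ℝ) (hα : -1 < α),
      (∀ x : ℝ, ((ClassicalFamily.laguerre α hα).q ![1, 2]).eval x ≠ 0) ∧
      ∀ l n : ℕ, l ∉ ({1, 2} : Set ℕ) → n ∉ ({1, 2} : Set ℕ) → l ≠ n →
        IntegrableOn (fun x : ℝ => ((ClassicalFamily.laguerre α hα).P ![1, 2] l).eval x *
            ((ClassicalFamily.laguerre α hα).P ![1, 2] n).eval x *
            (x ^ (α + 2) * Real.exp (-x) /
              (((ClassicalFamily.laguerre α hα).q ![1, 2]).eval x) ^ 2)) (Set.Ioi 0) ∧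
          ∫ x in Set.Ioi (0 : ℝ), ((ClassicalFamily.laguerre α hα).P ![1, 2] l).eval x *
            ((ClassicalFamily.laguerre α hα).P ![1, 2] n).eval x *
            (x ^ (α + 2) * Real.exp (-x) /
              (((ClassicalFamily.laguerre α hα).q ![1, 2]).eval x) ^ 2) = 0) := by
  refine ⟨fun p k i _ γ a b hγ hq ρ hρ hint hla hlb l n _ _ hln =>
    p.orthogonal_on_curve i hγ hq hρ hint hla hlb hln, fun α hα => ⟨fun x => ?_, ?_⟩⟩
  · have := ClassicalFamily.laguerre_q_one_two_eval_le α hα x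
    exact (this.trans_lt (by linarith)).ne
  · exact fun l n _ _ hln => ClassicalFamily.laguerre_one_two_orthogonal α hα hln
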